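/- All groups are abelian and written additively, and $p$ is a prime. A $p$-group is a group in which every element has order a power of $p$. A group $G$ is reduced if its only divisible subgroup is $\{0\}$, and bounded if $nG=\{0\}$ for some integer $n\ge 1$. A group $G$ is relatively Hopfian if, whenever $\phi\colon G\to G\oplus A$ is a surjective homomorphism for some group $A$, then $A=\{0\}$. For an ordinal $\sigma$, the subgroup $p^{\sigma}G$ is defined by $p^{0}G=G$, $p^{\sigma+1}G=p(p^{\sigma}G)$, and $p^{\sigma}G=\bigcap_{\tau<\sigma}p^{\tau}G$ for $\sigma$ a limit ordinal. A $p$-group $G$ is totally projective if $p^{\sigma}\operatorname{Ext}(G/p^{\sigma}G,C)=\{0\}$ for all ordinals $\sigma$ and all groups $C$. 1. Every countable reduced relatively Hopfian $p$-group is finite. 2. A reduced relatively Hopfian $p$-group has no countably infinite direct summand. 3. No reduced unbounded totally projective $p$-group is relatively Hopfian. -/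

import Mathlib

universe u

namespace AbGrp

/-- An (additively written) abelian group all of whose elements have order a power of `p`. -/
def IsPrimary (p : ℕ) (G : Type u) [AddCommGroup G] : Prop :=
  ∀ x : G, ∃ k : ℕ, p ^ k • x = 0

/-- A subgroup `D` is divisible if every element of `D` is divisible in `D` by every nonzero
natural number. -/
def IsDivisibleSubgroup {G : Type u} [AddCommGroup G] (D : AddSubgroup G) : Prop :=
  ∀ n : ℕ, n ≠ 0 → ∀ x ∈ D, ∃ y ∈ D, n • y = x

/-- A group is reduced if its only divisible subgroup is zero. -/
def IsReduced (G : Type u) [AddCommGroup G] : Prop :=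
  ∀ D : AddSubgroup G, IsDivisibleSubgroup D → D = ⊥

/-- `G` is bounded if some positive integer annihilates it. -/
def IsBounded (G : Type u) [AddCommGroup G] : Prop :=
  ∃ n : ℕ, 0 < n ∧ ∀ x : G, n • x = 0

/-- `G` is relatively Hopfian if a surjective homomorphism `G → G ⊕ A` exists only for `A = 0`.
(Any such `A` is a quotient of `G`, so letting `A` range over the universe of `G` loses
nothing.) -/
def IsRelativelyHopfian (G : Type u) [AddCommGroup G] : Prop :=
  ∀ (A : Type u) [AddCommGroup A] (φ : G →+ G × A), Function.Surjective φ → Subsingleton A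

/-- `H` is a direct summand of `G`: it has a complementary subgroup. -/
def IsDirectSummand {G : Type u} [AddCommGroup G] (H : AddSubgroup G) : Prop :=
  ∃ K : AddSubgroup G, IsCompl H K

/-- The subgroups `p ^ σ G`, for `σ` an ordinal: `p ^ 0 G = G`, `p ^ (σ + 1) G = p (p ^ σ G)`, and
`p ^ σ G` is the intersection of the `p ^ τ G`, `τ < σ`, for a limit ordinal `σ`. -/
noncomputable def primePow (p : ℕ) (G : Type u) [AddCommGroup G] (σ : Ordinal.{u}) :
    AddSubgroup G :=
  Ordinal.limitRecOn σ ⊤ (fun _ H => H.map (nsmulAddMonoidHom p))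
    (fun _ _ H => ⨅ (τ) (hτ), H τ hτ)

theorem primePow_zero (p : ℕ) (G : Type u) [AddCommGroup G] : primePow p G 0 = ⊤ :=
  Ordinal.limitRecOn_zero ..

theorem primePow_add_one (p : ℕ) (G : Type u) [AddCommGroup G] (σ : Ordinal.{u}) :
    primePow p G (σ + 1) = (primePow p G σ).map (nsmulAddMonoidHom p) :=
  Ordinal.limitRecOn_add_one ..

theorem primePow_limit (p : ℕ) (G : Type u) [AddCommGroup G] (σ : Ordinal.{u})
    (hσ : Order.IsSuccLimit σ) : primePow p G σ = ⨅ τ < σ, primePow p G τ :=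
  Ordinal.limitRecOn_limit _ _ _ _ hσ

/-- The group `Ext(A, C) = Ext¹(A, C)` of abelian groups, i.e. of `ℤ`-modules. -/
abbrev ExtGroup (A C : Type u) [AddCommGroup A] [AddCommGroup C] : Type u :=
  CategoryTheory.Abelian.Ext.{u} (ModuleCat.of ℤ A) (ModuleCat.of ℤ C) 1

/-- Nunke's definition: a `p`-group `G` is totally projective if
`p ^ σ Ext(G / p ^ σ G, C) = 0` for all ordinals `σ` and all abelian groups `C`. -/
def IsTotallyProjective (p : ℕ) (G : Type u) [AddCommGroup G] : Prop :=
  IsPrimary p G ∧ ∀ (σ : Ordinal.{u}) (C : Type u) [AddCommGroup C],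
    primePow p (ExtGroup (G ⧸ primePow p G σ) C) σ = ⊥

end AbGrp

/-!
The three parts rest on two facts about a `p`-group `G`.

First, if `G` is relatively Hopfian, each of its Ulm invariants of finite index is finite
(`IsRelativelyHopfian.exists_finite_set`): an infinite one yields a direct summand that is an
infinite direct sum of copies of `ℤ / p ^ (n + 1)`, and the left shift maps such a summand onto itself
plus another copy of `ℤ / p ^ (n + 1)`. Lifts of the Ulm factors generate `G` modulo `p G`; hence
`G` is finite if it is bounded, and has countable `G / p G` in any case.

Secondly, if `G` is reduced and unbounded, it maps onto every countable `p`-group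
(`exists_surjective_of_countable`). It has cyclic direct summands of arbitrarily large order, and
mapping sufficiently sparse ones to generators of the target gives a locally finite sum of
homomorphisms. So a countable unbounded `G` maps onto `G × ℤ / p`. These facts prove the statement on
countable groups. The one on summands follows, since retracts of relatively Hopfian groups are
relatively Hopfian.

For a totally projective `G`, it remains to deduce that `G` is countable from the countability of
`G / p G`, which is done by showing that all `G / p ^ σ G` are countable
(`IsTotallyProjective.countable_quotient`). The step from `σ` to `σ + 1` is elementary. For a limit
ordinal `σ`, the group `A = G / p ^ σ G` embeds in a direct sum of groups `X i` with
`p ^ τ (X i) = 0` for some `τ < σ` (`exists_embedding_of_primePow_ext_eq_bot`). A countable subgroup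
generating `G` modulo `p G` has only countably many nonzero components; every other component of the
embedding has a `p`-divisible image, so it vanishes, while each of the countably many remaining ones
factors through a countable `G / p ^ τ G`.

The embedding comes from a map `f : X → A` with `p ^ σ X = 0`, built by recursion on `σ`: the pullback
of `f` along multiplication by `p` at successors and a direct sum at limits. It is such that every
class in `Ext(A, C)` killed by `f` lies in `p ^ σ Ext(A, C)`. At an infinite limit `σ` the map `f` is
surjective, and the class of the extension `ker f → X → A`, being killed by `f`, lies in
`p ^ σ Ext(A, ker f) = 0`, so `f` splits. To avoid higher `Ext` groups, classes are represented by
homomorphisms to `D / C`, where `C` is embedded in a divisible group `D` (`Detects`).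
-/

universe v w

namespace AbGrp

/-! ### The subgroups `p ^ σ G` -/

theorem primePow_add_one_le (p : ℕ) (G : Type u) [AddCommGroup G] (σ : Ordinal.{u}) :
    primePow p G (σ + 1) ≤ primePow p G σ := by
  rw [primePow_add_one]
  rintro _ ⟨x, hx, rfl⟩
  exact AddSubgroup.nsmul_mem _ hx p

theorem primePow_anti (p : ℕ) (G : Type u) [AddCommGroup G] {τ σ : Ordinal.{u}} (h : τ ≤ σ) :
    primePow p G σ ≤ primePow p G τ := by
  induction σ using Ordinal.limitRecOn with
  | zero => rw [nonpos_iff_eq_zero.1 h]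
  | add_one σ ih =>
    rcases h.eq_or_lt with rfl | h
    · exact le_rfl
    · exact (primePow_add_one_le p G σ).trans (ih (Order.lt_add_one_iff.1 h))
  | limit σ hσ _ =>
    rcases h.eq_or_lt with rfl | h
    · exact le_rfl
    · rw [primePow_limit _ _ _ hσ]
      exact iInf₂_le τ h

theorem map_mem_primePow {p : ℕ} {G H : Type u} [AddCommGroup G] [AddCommGroup H] (f : G →+ H)
    {σ : Ordinal.{u}} {x : G} (hx : x ∈ primePow p G σ) : f x ∈ primePow p H σ := by
  induction σ using Ordinal.limitRecOn generalizing x with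
  | zero => simp [primePow_zero]
  | add_one σ ih =>
    rw [primePow_add_one] at hx ⊢
    obtain ⟨y, hy, rfl⟩ := hx
    exact ⟨f y, ih hy, by simp⟩
  | limit σ hσ ih =>
    rw [primePow_limit _ _ _ hσ] at hx ⊢
    simp only [AddSubgroup.mem_iInf] at hx ⊢
    exact fun τ hτ => ih τ hτ (hx τ hτ)

theorem le_primePow_of_forall_exists_nsmul {p : ℕ} {G : Type u} [AddCommGroup G]
    {D : AddSubgroup G} (hD : ∀ x ∈ D, ∃ y ∈ D, p • y = x) (σ : Ordinal.{u}) :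
    D ≤ primePow p G σ := by
  induction σ using Ordinal.limitRecOn with
  | zero => simp [primePow_zero]
  | add_one σ ih =>
    intro x hx
    obtain ⟨y, hy, rfl⟩ := hD x hx
    rw [primePow_add_one]
    exact ⟨y, ih hy, rfl⟩
  | limit σ hσ ih =>
    rw [primePow_limit _ _ _ hσ]
    exact le_iInf₂ ih

/-- In a `p`-group, divisibility by `p` implies divisibility by every positive integer. -/
theorem IsPrimary.isDivisibleSubgroup {p : ℕ} (hp : p.Prime) {G : Type u} [AddCommGroup G]
    (hG : IsPrimary p G) {D : AddSubgroup G} (hD : ∀ x ∈ D, ∃ y ∈ D, p • y = x) :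
    IsDivisibleSubgroup D := by
  have hcop : ∀ m : ℕ, p.Coprime m → ∀ x ∈ D, ∃ y ∈ D, m • y = x := by
    intro m hm x hx
    obtain ⟨k, hk⟩ := hG x
    have h1 : IsCoprime ((p ^ k : ℕ) : ℤ) (m : ℤ) := (hm.pow_left k).isCoprime
    obtain ⟨a, b, hab⟩ := h1
    refine ⟨b • x, D.zsmul_mem hx b, ?_⟩
    have h2 : (a * ((p ^ k : ℕ) : ℤ) + b * (m : ℤ)) • x = x := by rw [hab, one_smul]
    rw [add_smul, mul_smul, natCast_zsmul, hk, smul_zero, zero_add] at h2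
    rw [← natCast_zsmul, smul_smul, mul_comm, h2]
  have hpow : ∀ k : ℕ, ∀ x ∈ D, ∃ y ∈ D, p ^ k • y = x := by
    intro k
    induction k with
    | zero => exact fun x hx => ⟨x, hx, by simp⟩
    | succ k ih =>
      intro x hx
      obtain ⟨y, hy, rfl⟩ := ih x hx
      obtain ⟨z, hz, rfl⟩ := hD y hy
      exact ⟨z, hz, by rw [pow_succ, mul_smul]⟩
  intro n hn x hx
  obtain ⟨k, m, hm, rfl⟩ := Nat.exists_eq_pow_mul_and_not_dvd hn p hp.ne_one
  obtain ⟨y, hy, rfl⟩ := hpow k x hx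
  obtain ⟨z, hz, rfl⟩ := hcop m ((Nat.Prime.coprime_iff_not_dvd hp).2 hm) y hy
  exact ⟨z, hz, mul_smul _ _ _⟩

/-- The descending chain `p ^ σ G` becomes stationary at a divisible subgroup. -/
theorem IsReduced.exists_primePow_eq_bot {p : ℕ} (hp : p.Prime) {G : Type u} [AddCommGroup G]
    (hG : IsPrimary p G) (hr : IsReduced G) : ∃ σ : Ordinal.{u}, primePow p G σ = ⊥ := by
  have h := not_injective_of_ordinal (primePow p G)
  simp only [Function.Injective, not_forall] at h
  obtain ⟨σ, τ, hστ, hne⟩ := h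
  wlog hlt : σ < τ generalizing σ τ
  · exact this τ σ hστ.symm (Ne.symm hne) (lt_of_le_of_ne (not_lt.1 hlt) (Ne.symm hne))
  refine ⟨σ, hr _ (hG.isDivisibleSubgroup hp fun x hx => ?_)⟩
  rw [hστ] at hx
  have hx' := primePow_anti p G (Order.add_one_le_of_lt hlt) hx
  rwa [primePow_add_one] at hx'

/-! ### A projective resolution adapted to `p ^ σ Ext` -/

/-- Over a divisible group, homomorphisms extend from subgroups. -/
theorem exists_extension_of_divisible {D : Type*} [AddCommGroup D]
    (hD : ∀ n : ℕ, n ≠ 0 → ∀ x : D, ∃ y, n • y = x) {X Y : Type*} [AddCommGroup X] [AddCommGroup Y]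
    (i : X →+ Y) (hi : Function.Injective i) (f : X →+ D) : ∃ g : Y →+ D, g.comp i = f := by
  have : DivisibleBy D ℕ := divisibleByOfSMulRightSurj D ℕ fun {n} hn x => hD n hn x
  have : DivisibleBy D ℤ := AddGroup.divisibleByIntOfDivisibleByNat D
  exact (Module.Baer.of_divisible D).extension_property_addMonoidHom i hi f

/-- A map `f : X → A` detects `p ^ σ` if, whenever `g : A → Q` is such that `g ∘ f` lifts along
`π : D → Q`, then `δ g` lies in `p ^ σ Λ`. Here `D` and `Q` are divisible, and `δ : Hom(A, Q) → Λ` is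
any homomorphism that kills the maps lifting along `π`. The intended example is the connecting
homomorphism with `Λ = Ext(A, ker π)`, where the condition says that a class killed by pullback along
`f` lies in `p ^ σ Ext(A, ker π)`. -/
def Detects (p : ℕ) {A X : Type u} [AddCommGroup A] [AddCommGroup X] (f : X →+ A)
    (σ : Ordinal.{u}) : Prop :=
  ∀ (D Q Λ : Type u) [AddCommGroup D] [AddCommGroup Q] [AddCommGroup Λ]
    (_ : ∀ n : ℕ, n ≠ 0 → ∀ x : D, ∃ y, n • y = x) (_ : ∀ n : ℕ, n ≠ 0 → ∀ x : Q, ∃ y, n • y = x)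
    (π : D →+ Q) (δ : (A →+ Q) →+ Λ) (_ : ∀ v : A →+ D, δ (π.comp v) = 0)
    (g : A →+ Q) (h : X →+ D), π.comp h = g.comp f → δ g ∈ primePow p Λ σ

/-- The pullback of `f : X → A` along multiplication by `p` on `A`. -/
def mulPullback (p : ℕ) {A X : Type u} [AddCommGroup A] [AddCommGroup X] (f : X →+ A) :
    AddSubgroup (X × A) :=
  AddMonoidHom.eqLocus (f.comp (AddMonoidHom.fst X A))
    ((nsmulAddMonoidHom p).comp (AddMonoidHom.snd X A))

/-- If `g ∘ snd` lifts on the pullback, then after subtracting from `g` a map that lifts along `π`,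
it becomes `p • g'` with `g' ∘ f` lifting along `π`. Divisibility of `D` and `Q` is used to
extend the lift to `X × A` and `g'` to all of `A`. -/
theorem Detects.mulPullback {p : ℕ} {A X : Type u} [AddCommGroup A] [AddCommGroup X] {f : X →+ A}
    {σ : Ordinal.{u}} (hf : Detects p f σ) :
    Detects p ((AddMonoidHom.snd X A).comp (mulPullback p f).subtype) (σ + 1) := by
  intro D Q Λ _ _ _ hD hQ π δ hδ g h hgh
  obtain ⟨w, hw⟩ := exists_extension_of_divisible hD (AbGrp.mulPullback p f).subtype
    (AbGrp.mulPullback p f).subtype_injective h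
  let u := w.comp (AddMonoidHom.inl X A)
  let v := w.comp (AddMonoidHom.inr X A)
  have hkey : ∀ (x : X) (a : A), f x = p • a → π (u x) + π (v a) = g a := by
    intro x a hxa
    have h1 := DFunLike.congr_fun hgh ⟨(x, a), hxa⟩
    have h2 := DFunLike.congr_fun hw ⟨(x, a), hxa⟩
    simp only [AddMonoidHom.comp_apply, AddSubgroup.subtype_apply, AddMonoidHom.coe_snd] at h1 h2
    rw [← h1, ← h2, ← map_add]
    simp [u, v, ← map_add]
  -- `g₀` has the same image under `δ` as `g`, and `(x, a) ↦ π (u x) - g₀ a` factors through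
  -- `(x, a) ↦ f x - p • a`; this defines `g'` on the range of the latter.
  let g₀ : A →+ Q := g - π.comp v
  let d : X × A →+ A := f.coprod (-nsmulAddMonoidHom p)
  let c : X × A →+ Q := (π.comp u).coprod (-g₀)
  have hker : d.ker ≤ c.ker := by
    rintro ⟨x, a⟩ hxa
    rw [AddMonoidHom.mem_ker] at hxa ⊢
    have : f x = p • a := by
      rw [← sub_eq_zero, ← hxa]
      simp [d, sub_eq_add_neg]
    have h1 := hkey x a this
    simp [c, g₀, ← h1]
  let e : d.range →+ Q :=
    (QuotientAddGroup.lift d.ker c hker).comp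
      (QuotientAddGroup.quotientKerEquivRange d).symm.toAddMonoidHom
  obtain ⟨g', hg'⟩ := exists_extension_of_divisible hQ d.range.subtype
    d.range.subtype_injective e
  have hg'd : ∀ y, g' (d y) = c y := by
    intro y
    have h1 := DFunLike.congr_fun hg' ⟨d y, y, rfl⟩
    have h2 : (QuotientAddGroup.quotientKerEquivRange d).symm ⟨d y, y, rfl⟩ =
        QuotientAddGroup.mk y := by
      rw [AddEquiv.symm_apply_eq]
      rfl
    simp only [AddMonoidHom.comp_apply, AddSubgroup.subtype_apply] at h1
    rw [h1]
    simp only [e, AddMonoidHom.comp_apply]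
    erw [h2]
    rfl
  have h1 : δ g' ∈ primePow p Λ σ := by
    refine hf D Q Λ hD hQ π δ hδ g' u ?_
    ext x
    have := hg'd (x, 0)
    simpa [d, c] using this.symm
  have h2 : g = p • g' + π.comp v := by
    ext a
    have := hg'd (0, a)
    simp only [d, c, g₀, AddMonoidHom.coprod_apply, map_zero, zero_add, AddMonoidHom.neg_apply,
      map_neg, neg_inj, nsmulAddMonoidHom_apply, map_nsmul, AddMonoidHom.sub_apply] at this
    simp [this]
  rw [primePow_add_one]
  exact ⟨δ g', h1, by rw [h2, map_add, hδ, map_nsmul, add_zero]; rfl⟩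

theorem Detects.of_comp {p : ℕ} {A X Y : Type u} [AddCommGroup A] [AddCommGroup X]
    [AddCommGroup Y] {f : X →+ A} {σ : Ordinal.{u}} (i : Y →+ X) (hf : Detects p (f.comp i) σ) :
    Detects p f σ := by
  intro D Q Λ _ _ _ hD hQ π δ hδ g h hgh
  exact hf D Q Λ hD hQ π δ hδ g (h.comp i) (by
    rw [← AddMonoidHom.comp_assoc, hgh, AddMonoidHom.comp_assoc])

theorem Detects.of_isSuccLimit {p : ℕ} {A X : Type u} [AddCommGroup A] [AddCommGroup X]
    {f : X →+ A} {σ : Ordinal.{u}} (hσ : Order.IsSuccLimit σ) (hf : ∀ τ < σ, Detects p f τ) :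
    Detects p f σ := by
  intro D Q Λ _ _ _ hD hQ π δ hδ g h hgh
  rw [primePow_limit _ _ _ hσ]
  simp only [AddSubgroup.mem_iInf]
  exact fun τ hτ => hf τ hτ D Q Λ hD hQ π δ hδ g h hgh

/-- The direct sum of a family of maps, as used at limit ordinals. -/
theorem detects_liftAddHom {p : ℕ} {A : Type u} [AddCommGroup A] {σ : Ordinal.{u}}
    (hσ : Order.IsSuccLimit σ) {X : σ.ToType → Type u} [∀ i, AddCommGroup (X i)]
    {f : ∀ i, X i →+ A} (hf : ∀ i, Detects p (f i) (Ordinal.ToType.toOrd i : Ordinal)) :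
    Detects p (DFinsupp.liftAddHom f) σ := by
  refine Detects.of_isSuccLimit hσ fun τ hτ => ?_
  have h := hf (Ordinal.ToType.mk ⟨τ, hτ⟩)
  simp only [OrderIso.symm_apply_apply] at h
  refine Detects.of_comp (DFinsupp.singleAddHom X (Ordinal.ToType.mk ⟨τ, hτ⟩)) ?_
  rwa [DFinsupp.liftAddHom_comp_single]

/-- For every `σ` there is a map `f : X → A` that detects `p ^ σ` with `p ^ σ X = 0`, and every
element of `A` of finite order `p ^ n`, `n ≤ σ`, is in the range of `f`. -/
theorem exists_detects (p : ℕ) (A : Type u) [AddCommGroup A] (σ : Ordinal.{u}) :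
    ∃ (X : Type u) (_ : AddCommGroup X) (f : X →+ A), Detects p f σ ∧ primePow p X σ = ⊥ ∧
      ∀ (n : ℕ), (n : Ordinal.{u}) ≤ σ → ∀ x : A, p ^ n • x = 0 → x ∈ f.range := by
  induction σ using Ordinal.limitRecOn with
  | zero =>
    refine ⟨PUnit, inferInstance, 0, ?_, Subsingleton.elim _ _, ?_⟩
    · intro D Q Λ _ _ _ hD hQ π δ hδ g h hgh
      simp [primePow_zero]
    · intro n hn x hx
      have : n = 0 := by simpa using hn
      subst this
      simp only [pow_zero, one_smul] at hx
      simp [hx]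
  | add_one σ ih =>
    obtain ⟨X, _, f, hf, hX, hr⟩ := ih
    refine ⟨_, inferInstance, _, hf.mulPullback, ?_, ?_⟩
    · rw [primePow_add_one, eq_bot_iff]
      rintro _ ⟨y, hy, rfl⟩
      have h1 := map_mem_primePow ((AddMonoidHom.fst X A).comp (mulPullback p f).subtype) hy
      rw [hX, AddSubgroup.mem_bot] at h1
      have h1' : y.1.1 = 0 := h1
      have h2 : f y.1.1 = p • y.1.2 := y.2
      rw [h1', map_zero] at h2
      rw [AddSubgroup.mem_bot]
      refine Subtype.ext (Prod.ext ?_ ?_)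
      · change p • y.1.1 = 0
        rw [h1', smul_zero]
      · exact h2.symm
    · rintro (_ | n) hn x hx
      · simp only [pow_zero, one_smul] at hx
        exact hx ▸ AddSubgroup.zero_mem _
      · have hn' : (n : Ordinal.{u}) ≤ σ := by
          rw [Nat.cast_succ] at hn
          exact Order.lt_add_one_iff.1 (Order.add_one_le_iff.1 hn)
        obtain ⟨y, hy⟩ := hr n hn' (p • x) (by rw [smul_smul, ← pow_succ, hx])
        exact ⟨⟨(y, x), hy⟩, rfl⟩
  | limit σ hσ ih =>
    have ih' : ∀ i : σ.ToType, _ := fun i => ih (Ordinal.ToType.toOrd i) (Ordinal.ToType.toOrd i).2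
    choose X _ f hf hX hr using ih'
    refine ⟨Π₀ i, X i, inferInstance, _, detects_liftAddHom hσ hf, ?_, ?_⟩
    · rw [eq_bot_iff]
      intro x hx
      rw [AddSubgroup.mem_bot]
      ext i
      have h1 := map_mem_primePow (DFinsupp.evalAddMonoidHom i)
        (primePow_anti p _ (le_of_lt (Set.mem_Iio.1 (Ordinal.ToType.toOrd i).2)) hx)
      rwa [hX, AddSubgroup.mem_bot] at h1
    · intro n hn x hx
      have hn' : (n : Ordinal.{u}) < σ := 
        (Ordinal.natCast_lt_omega0 n).trans_le (Ordinal.omega0_le_of_isSuccLimit hσ)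
      obtain ⟨y, hy⟩ := hr (Ordinal.ToType.mk ⟨n, hn'⟩) n (by simp) x hx
      exact ⟨DFinsupp.single _ y, by simpa using hy⟩

/-! ### Embedding totally projective groups into direct sums -/

/-- Every abelian group `C` embeds in a divisible one, here a power of `ℚ / ℤ` indexed by the
characters of `C`. -/
theorem exists_divisible_embedding (C : Type u) [AddCommGroup C] :
    ∃ (D : Type u) (_ : AddCommGroup D) (i : C →+ D),
      (∀ n : ℕ, n ≠ 0 → ∀ x : D, ∃ y, n • y = x) ∧ Function.Injective i := by
  refine ⟨CharacterModule C → AddCircle (1 : ℚ), inferInstance,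
    AddMonoidHom.pi fun χ => (χ : C →+ AddCircle (1 : ℚ)), fun n hn x => ?_, ?_⟩
  · refine ⟨fun χ => DivisibleBy.div (x χ) (n : ℤ), funext fun χ => ?_⟩
    have := DivisibleBy.div_cancel (x χ) (n := (n : ℤ)) (by exact_mod_cast hn)
    rwa [natCast_zsmul] at this
  · rw [injective_iff_map_eq_zero]
    intro a ha
    by_contra hne
    obtain ⟨χ, hχ⟩ := CharacterModule.exists_character_apply_ne_zero_of_ne_zero hne
    exact hχ (congrFun ha χ)

open CategoryTheory in
/-- The connecting homomorphism `Hom(A, D / C) → Ext(A, C)`, with its exactness at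
`Hom(A, D / C)`. -/
theorem exists_connecting_hom {A C D : Type u} [AddCommGroup A] [AddCommGroup C] [AddCommGroup D]
    (i : C →+ D) (hi : Function.Injective i) :
    ∃ δ : (A →+ D ⧸ i.range) →+ ExtGroup A C, ∀ g : A →+ D ⧸ i.range,
      δ g = 0 ↔ ∃ v : A →+ D, (QuotientAddGroup.mk' i.range).comp v = g := by
  let S : ShortComplex (ModuleCat.{u} ℤ) :=
    ShortComplex.mk (ModuleCat.ofHom i.toIntLinearMap)
      (ModuleCat.ofHom (QuotientAddGroup.mk' i.range).toIntLinearMap) (by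
        ext x
        exact (QuotientAddGroup.eq_zero_iff _).2 ⟨x, rfl⟩)
  have hS : S.ShortExact := by
    have hm : Mono S.f := (ModuleCat.mono_iff_injective _).2 hi
    have he : Epi S.g := (ModuleCat.epi_iff_surjective _).2 (QuotientAddGroup.mk'_surjective _)
    refine ⟨(ShortComplex.moduleCat_exact_iff S).2 fun x hx => ?_⟩
    obtain ⟨y, hy⟩ := (QuotientAddGroup.eq_zero_iff _).1 hx
    exact ⟨y, hy⟩
  let δ : (A →+ D ⧸ i.range) →+ ExtGroup A C := AddMonoidHom.mk'
    (fun g => (Abelian.Ext.mk₀ (ModuleCat.ofHom g.toIntLinearMap : ModuleCat.of ℤ A ⟶ S.X₃)).comp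
      hS.extClass (zero_add 1)) (by
        intro g g'
        rw [← Abelian.Ext.add_comp, ← Abelian.Ext.mk₀_add]
        rfl)
  refine ⟨δ, fun g => ⟨fun hg => ?_, ?_⟩⟩
  · obtain ⟨x, hx⟩ := Abelian.Ext.covariant_sequence_exact₃ _ hS _ (zero_add 1) hg
    obtain ⟨v, rfl⟩ := Abelian.Ext.addEquiv₀.symm.surjective x
    have hx' : (Abelian.Ext.mk₀ v).comp (Abelian.Ext.mk₀ S.g) (add_zero 0) =
      Abelian.Ext.mk₀ (ModuleCat.ofHom g.toIntLinearMap : ModuleCat.of ℤ A ⟶ S.X₃) := hx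
    rw [Abelian.Ext.mk₀_comp_mk₀] at hx'
    have h1 := Abelian.Ext.addEquiv₀.symm.injective hx'
    refine ⟨v.hom.toAddMonoidHom, ?_⟩
    ext a
    exact congrArg (fun q => q.hom a) h1
  · rintro ⟨v, rfl⟩
    change (Abelian.Ext.mk₀ ((ModuleCat.ofHom v.toIntLinearMap : ModuleCat.of ℤ A ⟶ S.X₂) ≫
      S.g)).comp hS.extClass (zero_add 1) = 0
    rw [← Abelian.Ext.mk₀_comp_mk₀, Abelian.Ext.comp_assoc_of_second_deg_zero,
      hS.comp_extClass, Abelian.Ext.comp_zero]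

/-- A surjection that detects `p ^ σ` splits onto `A` as soon as `p ^ σ Ext(A, -) = 0`, since its
class in `Ext` lies in `p ^ σ Ext`. -/
theorem Detects.exists_section {p : ℕ} {A X : Type u} [AddCommGroup A] [AddCommGroup X]
    {f : X →+ A} {σ : Ordinal.{u}} (hf : Detects p f σ) (hsurj : Function.Surjective f)
    (hA : ∀ (C : Type u) [AddCommGroup C], primePow p (ExtGroup A C) σ = ⊥) :
    ∃ s : A →+ X, f.comp s = AddMonoidHom.id A := by
  obtain ⟨D, _, i, hD, hi⟩ := exists_divisible_embedding f.ker
  obtain ⟨δ, hδ⟩ := exists_connecting_hom (A := A) i hi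
  obtain ⟨h, hh⟩ := exists_extension_of_divisible hD f.ker.subtype f.ker.subtype_injective i
  let π := QuotientAddGroup.mk' i.range
  have hQ : ∀ n : ℕ, n ≠ 0 → ∀ x : D ⧸ i.range, ∃ y, n • y = x := by
    intro n hn x
    obtain ⟨x, rfl⟩ := QuotientAddGroup.mk'_surjective _ x
    obtain ⟨y, rfl⟩ := hD n hn x
    exact ⟨π y, (map_nsmul π n y).symm⟩
  have hker : f.ker ≤ (π.comp h).ker := by
    intro x hx
    exact (QuotientAddGroup.eq_zero_iff _).2 ⟨⟨x, hx⟩, (DFunLike.congr_fun hh ⟨x, hx⟩).symm⟩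
  let g : A →+ D ⧸ i.range := f.liftOfSurjective hsurj ⟨π.comp h, hker⟩
  have hg : g.comp f = π.comp h := AddMonoidHom.liftOfRightInverse_comp f _ _ _
  have hmem := hf D _ _ hD hQ π δ (fun v => (hδ _).2 ⟨v, rfl⟩) g h hg.symm
  rw [hA, AddSubgroup.mem_bot, hδ] at hmem
  obtain ⟨v, hv⟩ := hmem
  -- `h - v ∘ f` takes values in `ker f` and restricts to the identity there.
  have hr : ∀ x, ∃ c : f.ker, i c = h x - v (f x) := by
    intro x
    have : π (h x - v (f x)) = 0 := by
      rw [map_sub, sub_eq_zero]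
      exact (DFunLike.congr_fun hg x).symm.trans (DFunLike.congr_fun hv (f x)).symm
    exact (QuotientAddGroup.eq_zero_iff _).1 this
  choose r hr using hr
  let s : X →+ X := AddMonoidHom.mk' (fun x => x - (r x : X)) (by
    intro x y
    have : r (x + y) = r x + r y := hi (by simp only [map_add, hr]; abel)
    rw [this]
    push_cast
    abel)
  have hs : f.ker ≤ s.ker := by
    intro x hx
    have h1 : r x = ⟨x, hx⟩ := by
      refine hi ?_
      rw [hr, (AddMonoidHom.mem_ker).1 hx, map_zero, sub_zero]
      exact DFunLike.congr_fun hh ⟨x, hx⟩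
    rw [AddMonoidHom.mem_ker]
    change x - (r x : X) = 0
    rw [h1, sub_self]
  refine ⟨f.liftOfSurjective hsurj ⟨s, hs⟩, ?_⟩
  ext a
  obtain ⟨x, rfl⟩ := hsurj a
  have h1 : f.liftOfSurjective hsurj ⟨s, hs⟩ (f x) = s x :=
    DFunLike.congr_fun (AddMonoidHom.liftOfRightInverse_comp f (Function.surjInv hsurj)
      (Function.rightInverse_surjInv hsurj) ⟨s, hs⟩) x
  change f (f.liftOfSurjective hsurj ⟨s, hs⟩ (f x)) = f x
  rw [h1]
  change f (x - (r x : X)) = f x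
  rw [map_sub, (AddMonoidHom.mem_ker).1 (r x).2, sub_zero]

/-- At a limit ordinal `σ`, a `p`-group `A` with `p ^ σ Ext(A, -) = 0` embeds in a direct sum of
groups `X i` with `p ^ τ (X i) = 0` for some `τ < σ`, depending on `i`. -/
theorem exists_embedding_of_primePow_ext_eq_bot {p : ℕ} {A : Type u} [AddCommGroup A]
    (hA : IsPrimary p A) {σ : Ordinal.{u}} (hσ : Order.IsSuccLimit σ)
    (hExt : ∀ (C : Type u) [AddCommGroup C], primePow p (ExtGroup A C) σ = ⊥) :
    ∃ (ι : Type u) (X : ι → Type u) (_ : ∀ i, AddCommGroup (X i)) (j : A →+ Π₀ i, X i),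
      Function.Injective j ∧ ∀ i, ∃ τ < σ, primePow p (X i) τ = ⊥ := by
  choose X _ f hf hX hr using fun i : σ.ToType =>
    exists_detects p A (Ordinal.ToType.toOrd i : Ordinal)
  have hsurj : Function.Surjective (DFinsupp.liftAddHom f) := by
    intro x
    obtain ⟨n, hn⟩ := hA x
    have hnσ : (n : Ordinal.{u}) < σ :=
      (Ordinal.natCast_lt_omega0 n).trans_le (Ordinal.omega0_le_of_isSuccLimit hσ)
    obtain ⟨y, hy⟩ := hr (Ordinal.ToType.mk ⟨n, hnσ⟩) n (by simp) x hn
    exact ⟨DFinsupp.single _ y, by simpa using hy⟩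
  obtain ⟨s, hs⟩ := (detects_liftAddHom hσ hf).exists_section hsurj hExt
  exact ⟨_, X, inferInstance, s, Function.LeftInverse.injective (g := DFinsupp.liftAddHom f)
    (DFunLike.congr_fun hs), fun i => ⟨_, (Ordinal.ToType.toOrd i).2, hX i⟩⟩

/-! ### Countability -/

theorem countable_addSubgroup_closure {G : Type*} [AddCommGroup G] {T : Set G} (hT : T.Countable) :
    Countable (AddSubgroup.closure T) := by
  have := hT.to_subtype
  have h : (AddSubgroup.closure T : Set G) =
      Set.range (Finsupp.linearCombination ℤ ((↑) : T → G)) := by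
    rw [← Submodule.span_int_eq_addSubgroupClosure, Submodule.coe_toAddSubgroup,
      ← LinearMap.coe_range, Finsupp.range_linearCombination, Subtype.range_coe]
  exact Set.countable_coe_iff.2 (h ▸ Set.countable_range _)

theorem countable_quotient_iff {G : Type*} [AddCommGroup G] {N : AddSubgroup G} :
    Countable (G ⧸ N) ↔ ∃ S : AddSubgroup G, Countable S ∧ S ⊔ N = ⊤ := by
  constructor
  · intro h
    refine ⟨AddSubgroup.closure (Set.range (Quotient.out : G ⧸ N → G)),
      countable_addSubgroup_closure (Set.countable_range _), ?_⟩
    rw [eq_top_iff]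
    intro x _
    have h1 : Quotient.out (x : G ⧸ N) ∈
        AddSubgroup.closure (Set.range (Quotient.out : G ⧸ N → G)) :=
      AddSubgroup.subset_closure ⟨_, rfl⟩
    have h2 : -Quotient.out (x : G ⧸ N) + x ∈ N :=
      QuotientAddGroup.eq.1 (QuotientAddGroup.out_eq' _)
    have h3 := AddSubgroup.add_mem_sup h1 h2
    rwa [add_neg_cancel_left] at h3
  · rintro ⟨S, hS, hSN⟩
    refine Function.Surjective.countable (f := fun s : S => ((s : G) : G ⧸ N)) fun x => ?_
    obtain ⟨x, rfl⟩ := QuotientAddGroup.mk_surjective x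
    obtain ⟨s, hs, n, hn, rfl⟩ := AddSubgroup.mem_sup.1 (hSN ▸ AddSubgroup.mem_top x)
    exact ⟨⟨s, hs⟩, by rw [QuotientAddGroup.eq]; simpa using hn⟩

/-- A totally projective group `G` such that `G / p G` is countable has countable quotients
`G / p ^ σ G`. At a limit `σ`, the components of the embedding of `G / p ^ σ G` outside the countable
support of generators modulo `p` vanish, their images being `p`-divisible, and the other
components factor through some `G / p ^ τ G` with `τ < σ`. -/
theorem IsTotallyProjective.countable_quotient {p : ℕ} {G : Type u} [AddCommGroup G]
    (hG : IsTotallyProjective p G) {S : AddSubgroup G} (hS : Countable S)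
    (hSp : ∀ x : G, ∃ s ∈ S, ∃ y, x = s + p • y) (σ : Ordinal.{u}) :
    Countable (G ⧸ primePow p G σ) := by
  classical
  induction σ using Ordinal.limitRecOn with
  | zero =>
    rw [countable_quotient_iff]
    exact ⟨⊥, inferInstance, by simp [primePow_zero]⟩
  | add_one σ ih =>
    obtain ⟨T, hT, hTσ⟩ := countable_quotient_iff.1 ih
    rw [countable_quotient_iff]
    refine ⟨AddSubgroup.closure (S ∪ T), countable_addSubgroup_closure
      ((Set.countable_coe_iff.1 hS).union (Set.countable_coe_iff.1 hT)), ?_⟩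
    rw [eq_top_iff, primePow_add_one]
    intro x _
    obtain ⟨s, hs, y, rfl⟩ := hSp x
    obtain ⟨t, ht, z, hz, rfl⟩ := AddSubgroup.mem_sup.1 (hTσ ▸ AddSubgroup.mem_top y)
    have h1 := AddSubgroup.add_mem _
      (AddSubgroup.subset_closure (k := (S ∪ T : Set G)) (Or.inl hs))
      (AddSubgroup.nsmul_mem _ (AddSubgroup.subset_closure (k := (S ∪ T : Set G)) (Or.inr ht)) p)
    have h2 : p • z ∈ (primePow p G σ).map (nsmulAddMonoidHom p) := ⟨z, hz, rfl⟩
    have h3 := AddSubgroup.add_mem_sup h1 h2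
    rwa [add_assoc, ← smul_add] at h3
  | limit σ hσ ih =>
    have hA : IsPrimary p (G ⧸ primePow p G σ) := by
      intro x
      obtain ⟨x, rfl⟩ := QuotientAddGroup.mk_surjective x
      obtain ⟨k, hk⟩ := hG.1 x
      exact ⟨k, by rw [← QuotientAddGroup.mk_nsmul, hk, QuotientAddGroup.mk_zero]⟩
    obtain ⟨ι, X, _, j, hj, hX⟩ := exists_embedding_of_primePow_ext_eq_bot hA hσ (hG.2 σ)
    let J : G →+ Π₀ i, X i := j.comp (QuotientAddGroup.mk' _)
    let I : Set ι := ⋃ s : S, ((J s).support : Set ι)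
    have hI : I.Countable := Set.countable_iUnion fun s => Finset.countable_toSet _
    have hzero : ∀ i ∉ I, ∀ x, J x i = 0 := by
      intro i hi x
      obtain ⟨τ, -, hτ⟩ := hX i
      have h1 : ((DFinsupp.evalAddMonoidHom i).comp J).range ≤ primePow p (X i) τ := by
        refine le_primePow_of_forall_exists_nsmul ?_ τ
        rintro _ ⟨x, rfl⟩
        obtain ⟨s, hs, y, rfl⟩ := hSp x
        have h2 : J s i = 0 := by
          by_contra hne
          exact hi (Set.mem_iUnion.2 ⟨⟨s, hs⟩, by simpa using hne⟩)
        refine ⟨J y i, ⟨y, rfl⟩, ?_⟩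
        change p • J y i = J (s + p • y) i
        rw [map_add, map_nsmul, DFinsupp.add_apply, h2, zero_add, DFinsupp.smul_apply]
      rw [hτ] at h1
      exact h1 ⟨x, rfl⟩
    have hcount : ∀ i, (Set.range fun x => J x i).Countable := by
      intro i
      obtain ⟨τ, hτσ, hτ⟩ := hX i
      obtain ⟨T, hT, hTτ⟩ := countable_quotient_iff.1 (ih τ hτσ)
      refine (Set.countable_range fun t : T => J t i).mono ?_
      rintro _ ⟨x, rfl⟩
      obtain ⟨t, ht, z, hz, rfl⟩ := AddSubgroup.mem_sup.1 (hTτ ▸ AddSubgroup.mem_top x)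
      have h1 := map_mem_primePow ((DFinsupp.evalAddMonoidHom i).comp J) hz
      rw [hτ, AddSubgroup.mem_bot] at h1
      have h1' : J z i = 0 := h1
      exact ⟨⟨t, ht⟩, by simp [h1']⟩
    let Z : AddSubgroup (Π₀ i, X i) := AddSubgroup.closure
      (⋃ i ∈ I, DFinsupp.single i '' Set.range fun x => J x i)
    have hZ : Countable Z := countable_addSubgroup_closure
      (hI.biUnion fun i _ => (hcount i).image _)
    have hJZ : ∀ x, J x ∈ Z := by
      intro x
      rw [← DFinsupp.sum_single (f := J x)]
      refine AddSubgroup.sum_mem _ fun i hi => AddSubgroup.subset_closure ?_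
      have hiI : i ∈ I := by
        by_contra h
        exact (DFinsupp.mem_support_iff.1 hi) (hzero i h x)
      exact Set.mem_iUnion₂.2 ⟨i, hiI, _, ⟨x, rfl⟩, rfl⟩
    refine Function.Injective.countable (β := Z) (f := fun a => ⟨j a, ?_⟩) ?_
    · obtain ⟨x, rfl⟩ := QuotientAddGroup.mk_surjective a
      exact hJZ x
    · intro a b hab
      exact hj (congrArg Subtype.val hab)

/-! ### Direct summands of relatively Hopfian groups -/

/-- If `G` is relatively Hopfian, then so is every retract `H` of `G`, whatever the universes of
`H` and `A`. -/
theorem IsRelativelyHopfian.subsingleton_of_retract {G : Type u} {H : Type v} {A : Type w}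
    [AddCommGroup G] [AddCommGroup H] [AddCommGroup A] (hG : IsRelativelyHopfian G)
    (r : G →+ H) (ι : H →+ G) (hr : ∀ h, r (ι h) = h) (φ : H →+ H × A)
    (hφ : Function.Surjective φ) : Subsingleton A := by
  have hsmall : Small.{u} A := by
    refine small_of_surjective (f := fun x : G => (φ (r x)).2) fun a => ?_
    obtain ⟨h, hh⟩ := hφ (0, a)
    exact ⟨ι h, by simp [hr, hh]⟩
  let e : Shrink.{u} A ≃+ A := Shrink.addEquiv
  let ψ : G →+ G × Shrink.{u} A :=
    AddMonoidHom.prod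
      (AddMonoidHom.id G - ι.comp r + ι.comp ((AddMonoidHom.fst H A).comp (φ.comp r)))
      (e.symm.toAddMonoidHom.comp ((AddMonoidHom.snd H A).comp (φ.comp r)))
  have hψ : Function.Surjective ψ := by
    rintro ⟨g, a⟩
    obtain ⟨h, hh⟩ := hφ (r g, e a)
    refine ⟨g - ι (r g) + ι h, ?_⟩
    have h1 : r (g - ι (r g) + ι h) = h := by simp [hr]
    refine Prod.ext ?_ ?_
    · change (g - ι (r g) + ι h) - ι (r (g - ι (r g) + ι h)) +
        ι (φ (r (g - ι (r g) + ι h))).1 = g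
      rw [h1, hh]
      abel
    · change e.symm (φ (r (g - ι (r g) + ι h))).2 = a
      rw [h1, hh]
      exact e.symm_apply_apply a
  have := hG _ ψ hψ
  exact e.symm.injective.subsingleton

/-- A homogeneous subgroup of exponent `p ^ (n + 1)` meeting `p ^ (n + 1) G` trivially is a direct
summand of `G`. Any subgroup that contains `p ^ (n + 1) G` and is maximal with trivial intersection
with the given one is a complement. -/
theorem exists_retraction {p n : ℕ} (hp : p.Prime) {G : Type u} {H : Type v} [AddCommGroup G]
    [AddCommGroup H] (hG : IsPrimary p G) (ι : H →+ G)
    (hH : ∀ h : H, p ^ n • h = 0 → ∃ h', h = p • h')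
    (hι : ∀ h y, ι h = p ^ (n + 1) • y → h = 0) :
    ∃ r : G →+ H, ∀ h, r (ι h) = h := by
  obtain ⟨K, hK₀, hK⟩ := zorn_le_nonempty₀ {K : AddSubgroup G | ∀ h, ι h ∈ K → h = 0} (by
    intro c hc hchain K hKc
    refine ⟨sSup c, fun h hh => ?_, fun L hL => le_sSup hL⟩
    obtain ⟨L, hL, hhL⟩ := (AddSubgroup.mem_sSup_of_directedOn ⟨K, hKc⟩ hchain.directedOn).1 hh
    exact hc hL h hhL) (nsmulAddMonoidHom (p ^ (n + 1)) : G →+ G).range (by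
      rintro h ⟨y, hy⟩
      exact hι h y hy.symm)
  have hpK : ∀ x : G, p ^ (n + 1) • x ∈ K := fun x => hK₀ ⟨x, rfl⟩
  have htop : ∀ m : ℕ, ∀ x : G, p ^ m • x = 0 → x ∈ ι.range ⊔ K := by
    intro m
    induction m with
    | zero =>
      intro x hx
      rw [pow_zero, one_smul] at hx
      exact hx ▸ AddSubgroup.zero_mem _
    | succ m ih =>
      intro x hx
      obtain ⟨_, ⟨h, rfl⟩, z, hz, hhz⟩ := AddSubgroup.mem_sup.1 (ih (p • x) (by
        rw [smul_smul, ← pow_succ, hx]))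
      obtain ⟨h', rfl⟩ := hH h (hK.prop _ (by
        have h1 : ι (p ^ n • h) = p ^ (n + 1) • x - p ^ n • z := by
          rw [pow_succ, mul_smul, ← hhz, smul_add, map_nsmul, add_sub_cancel_right]
        rw [h1]
        exact K.sub_mem (hpK x) (K.nsmul_mem hz _)))
      suffices x - ι h' ∈ ι.range ⊔ K by
        have h2 := AddSubgroup.add_mem _ this
          ((le_sup_left : ι.range ≤ ι.range ⊔ K) ⟨h', rfl⟩)
        rwa [sub_add_cancel] at h2
      set x' := x - ι h' with hx'
      have hpx' : p • x' ∈ K := by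
        rw [hx', smul_sub, ← hhz, map_nsmul, add_sub_cancel_left]
        exact hz
      by_contra hnot
      have hlt : ¬ K ⊔ AddSubgroup.zmultiples x' ≤ K := fun hle =>
        hnot ((le_sup_right : K ≤ ι.range ⊔ K)
          (hle ((le_sup_right : _ ≤ K ⊔ AddSubgroup.zmultiples x')
            (AddSubgroup.mem_zmultiples x'))))
      have hex : ¬ ∀ h, ι h ∈ K ⊔ AddSubgroup.zmultiples x' → h = 0 := fun hall =>
        hlt (hK.le_of_ge hall le_sup_left)
      push Not at hex
      obtain ⟨h₀, hh₀, hne⟩ := hex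
      obtain ⟨z₀, hz₀, _, ⟨c, rfl⟩, hsum⟩ := AddSubgroup.mem_sup.1 hh₀
      simp only at hsum
      by_cases hpc : (p : ℤ) ∣ c
      · obtain ⟨d, rfl⟩ := hpc
        refine hne (hK.prop _ ?_)
        rw [← hsum, mul_comm, mul_smul, natCast_zsmul]
        exact K.add_mem hz₀ (K.zsmul_mem hpx' d)
      · obtain ⟨a, b, hab⟩ := ((Nat.prime_iff_prime_int.1 hp).coprime_iff_not_dvd).2 hpc
        refine hnot ?_
        have h3 : x' = a • (p • x') + b • (ι h₀ - z₀) := by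
          rw [← hsum, add_sub_cancel_left, ← natCast_zsmul x' p, smul_smul, smul_smul, ← add_smul,
            hab, one_smul]
        rw [h3]
        have hKle : K ≤ ι.range ⊔ K := le_sup_right
        exact AddSubgroup.add_mem _ (AddSubgroup.zsmul_mem _ (hKle hpx') _)
          (AddSubgroup.zsmul_mem _ (AddSubgroup.sub_mem _
            ((le_sup_left : ι.range ≤ ι.range ⊔ K) ⟨h₀, rfl⟩) (hKle hz₀)) _)
  let q : H × K →+ G := ι.coprod K.subtype
  have hq : Function.Bijective q := by
    constructor
    · rw [injective_iff_map_eq_zero]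
      rintro ⟨h, z⟩ hhz
      have h1 : ι h + z = 0 := hhz
      have h2 : h = 0 := hK.prop _ (by rw [eq_neg_of_add_eq_zero_left h1]; exact K.neg_mem z.2)
      subst h2
      rw [map_zero, zero_add] at h1
      exact Prod.ext rfl (Subtype.ext h1)
    · intro x
      obtain ⟨m, hm⟩ := hG x
      obtain ⟨_, ⟨h, rfl⟩, z, hz, hhz⟩ := AddSubgroup.mem_sup.1 (htop m x hm)
      exact ⟨(h, ⟨z, hz⟩), hhz⟩
  let e := AddEquiv.ofBijective q hq
  refine ⟨(AddMonoidHom.fst H K).comp e.symm.toAddMonoidHom, fun h => ?_⟩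
  have h1 : e (h, 0) = ι h := by simp [e, q]
  change (e.symm (ι h)).1 = h
  rw [← h1, AddEquiv.symm_apply_apply]

theorem exists_eq_smul_of_forall_dvd {I : Type*} {a : ℤ} (c : I →₀ ℤ) (h : ∀ i, a ∣ c i) :
    ∃ d : I →₀ ℤ, c = a • d := by
  refine ⟨c.mapRange (· / a) (by simp), Finsupp.ext fun i => ?_⟩
  rw [Finsupp.smul_apply, Finsupp.mapRange_apply, smul_eq_mul, Int.mul_ediv_cancel' (h i)]

/-- Elements `b i` of order `p ^ (n + 1)` for which the `p ^ n • b i` are independent modulo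
`p ^ (n + 1) G` generate a direct summand, namely a direct sum of copies of `ℤ / p ^ (n + 1)`. -/
theorem exists_retract_finsupp_zmod {p n : ℕ} (hp : p.Prime) {G : Type u} [AddCommGroup G]
    (hG : IsPrimary p G) {I : Type*} (b : I → G) (hb : ∀ i, p ^ (n + 1) • b i = 0)
    (hind : ∀ (c : I →₀ ℤ) (y : G),
      p ^ n • Finsupp.linearCombination ℤ b c = p ^ (n + 1) • y → ∀ i, (p : ℤ) ∣ c i) :
    ∃ (ι : (I →₀ ZMod (p ^ (n + 1))) →+ G) (r : G →+ (I →₀ ZMod (p ^ (n + 1)))),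
      (∀ h, r (ι h) = h) ∧ ∀ i, ι (Finsupp.single i 1) = b i := by
  let ι : (I →₀ ZMod (p ^ (n + 1))) →+ G := Finsupp.liftAddHom fun i =>
    ZMod.lift (p ^ (n + 1)) ⟨zmultiplesHom G (b i), by
      rw [zmultiplesHom_apply, natCast_zsmul, hb]⟩
  let q : (I →₀ ℤ) →+ (I →₀ ZMod (p ^ (n + 1))) :=
    Finsupp.mapRange.addMonoidHom (Int.castAddHom _)
  have hq : Function.Surjective q :=
    Finsupp.mapRange_surjective _ (map_zero _) (ZMod.intCast_surjective)
  have hqapp : ∀ c i, q c i = (c i : ZMod (p ^ (n + 1))) := fun c i => rfl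
  have hιq : ∀ c, ι (q c) = Finsupp.linearCombination ℤ b c := by
    intro c
    have : ι.comp q = (Finsupp.linearCombination ℤ b).toAddMonoidHom := by
      refine Finsupp.addHom_ext fun i a => ?_
      simp only [AddMonoidHom.comp_apply, q, Finsupp.mapRange.addMonoidHom_apply,
        Finsupp.mapRange_single, ι, Finsupp.liftAddHom_apply_single, Int.coe_castAddHom,
        ZMod.lift_coe, zmultiplesHom_apply, LinearMap.toAddMonoidHom_coe,
        Finsupp.linearCombination_single]
    exact DFunLike.congr_fun this c
  have hqzero : ∀ c, q c = 0 ↔ ∀ i, ((p : ℤ) ^ (n + 1)) ∣ c i := by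
    intro c
    rw [Finsupp.ext_iff]
    refine forall_congr' fun i => ?_
    rw [hqapp, Finsupp.zero_apply, ZMod.intCast_zmod_eq_zero_iff_dvd]
    push_cast
    rfl
  have hp0 : (p : ℤ) ≠ 0 := by exact_mod_cast hp.ne_zero
  obtain ⟨r, hr⟩ := exists_retraction (n := n) hp hG ι (by
    intro h hh
    obtain ⟨c, rfl⟩ := hq h
    rw [← map_nsmul, hqzero] at hh
    obtain ⟨d, rfl⟩ := exists_eq_smul_of_forall_dvd (a := (p : ℤ)) c fun i => by
      have := hh i
      rw [Finsupp.smul_apply, nsmul_eq_mul, pow_succ, Nat.cast_pow] at this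
      exact Int.dvd_of_mul_dvd_mul_left (pow_ne_zero n hp0) this
    exact ⟨q d, by rw [natCast_zsmul, map_nsmul]⟩) (by
    intro h y hy
    obtain ⟨c, rfl⟩ := hq h
    rw [hιq] at hy
    -- The coefficients are divisible by successively higher powers of `p`.
    have hdiv : ∀ m ≤ n + 1, ∃ d : I →₀ ℤ, c = ((p : ℤ) ^ m) • d := by
      intro m
      induction m with
      | zero => exact fun _ => ⟨c, by simp⟩
      | succ m ih =>
        intro hm
        obtain ⟨d, hd⟩ := ih (by omega)
        have h1 : p ^ n • Finsupp.linearCombination ℤ b d = p ^ (n + 1) • (p ^ (n - m) • y) := by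
          rw [smul_smul, mul_comm, mul_smul, ← hy, hd, map_smul, ← Nat.cast_pow, natCast_zsmul,
            smul_smul, ← pow_add, Nat.sub_add_cancel (by omega)]
        obtain ⟨e, rfl⟩ := exists_eq_smul_of_forall_dvd d (hind d _ h1)
        exact ⟨e, by rw [hd, smul_smul, pow_succ]⟩
    obtain ⟨d, rfl⟩ := hdiv (n + 1) le_rfl
    rw [hqzero]
    exact fun i => ⟨d i, by simp⟩)
  refine ⟨ι, r, hr, fun i => ?_⟩
  have := hιq (Finsupp.single i 1)
  rw [Finsupp.linearCombination_single, one_smul] at this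
  rw [← this]
  simp [q]

theorem exists_nat_linearIndependent (K : Type*) (V : Type*) [Field K] [Finite K] [AddCommGroup V]
    [Module K V] [Infinite V] : ∃ v : ℕ → V, LinearIndependent K v := by
  let B := Module.Basis.ofVectorSpace K V
  have : Infinite (Module.Basis.ofVectorSpaceIndex K V) := by
    by_contra h
    rw [not_infinite_iff_finite] at h
    have := Module.Finite.of_basis B
    have := Module.finite_of_finite K (M := V)
    exact not_finite V
  let ν := Infinite.natEmbedding (Module.Basis.ofVectorSpaceIndex K V)
  exact ⟨_, B.linearIndependent.comp ν ν.injective⟩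

/-- An infinite group of exponent `p` contains infinitely many independent elements. -/
theorem exists_independent_of_infinite {p : ℕ} (hp : p.Prime) {R : Type*} [AddCommGroup R]
    [Infinite R] (hR : ∀ x : R, p • x = 0) :
    ∃ v : ℕ → R, ∀ c : ℕ →₀ ℤ, Finsupp.linearCombination ℤ v c = 0 → ∀ i, (p : ℤ) ∣ c i := by
  have : Fact p.Prime := ⟨hp⟩
  let _ : Module (ZMod p) R := AddCommGroup.zmodModule hR
  obtain ⟨v, hv⟩ := exists_nat_linearIndependent (ZMod p) R
  refine ⟨v, fun c hc i => ?_⟩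
  have h1 : ∑ j ∈ c.support, ((c j : ℤ) : ZMod p) • v j = 0 := by
    simpa only [Int.cast_smul_eq_zsmul, Finsupp.linearCombination_apply, Finsupp.sum] using hc
  by_cases hi : i ∈ c.support
  · exact (ZMod.intCast_zmod_eq_zero_iff_dvd _ _).1
      (linearIndependent_iff'.1 hv c.support _ h1 i hi)
  · rw [Finsupp.notMem_support_iff.1 hi]
    exact dvd_zero _

/-- In a relatively Hopfian `p`-group `G`, the image of `p ^ n G[p ^ (n + 1)]` in
`G / p ^ (n + 1) G`, whose dimension over `ℤ / p` is a Ulm invariant, is finite. Otherwise `G` has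
a direct summand isomorphic to an infinite direct sum of copies of `ℤ / p ^ (n + 1)`, and the left
shift shows that this summand is not relatively Hopfian. -/
theorem IsRelativelyHopfian.exists_finite_set {p : ℕ} (hp : p.Prime) {G : Type u} [AddCommGroup G]
    (hG : IsPrimary p G) (hRH : IsRelativelyHopfian G) (n : ℕ) :
    ∃ T : Set G, T.Finite ∧
      ∀ x : G, p ^ (n + 1) • x = 0 → ∃ t ∈ T, ∃ y, p ^ n • x = p ^ n • t + p ^ (n + 1) • y := by
  let M : AddSubgroup G := (nsmulAddMonoidHom (p ^ (n + 1)) : G →+ G).ker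
  let N : AddSubgroup G := (nsmulAddMonoidHom (p ^ (n + 1)) : G →+ G).range
  let φ : M →+ G ⧸ N :=
    (QuotientAddGroup.mk' N).comp ((nsmulAddMonoidHom (p ^ n)).comp M.subtype)
  have hfin : Finite φ.range := by
    by_contra hinf
    rw [not_finite_iff_infinite] at hinf
    have hpR : ∀ x : φ.range, p • x = 0 := by
      rintro ⟨_, x, rfl⟩
      refine Subtype.ext ?_
      change p • φ x = 0
      rw [← map_nsmul]
      refine (QuotientAddGroup.eq_zero_iff _).2 ⟨0, ?_⟩
      have hx : p ^ (n + 1) • (x : G) = 0 := x.2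
      change p ^ (n + 1) • (0 : G) = p ^ n • (p • (x : G))
      rw [smul_zero, smul_smul, ← pow_succ, hx]
    obtain ⟨v, hv⟩ := exists_independent_of_infinite hp hpR
    choose b hb using fun i => (v i).2
    obtain ⟨ι, r, hr, -⟩ := exists_retract_finsupp_zmod hp hG (fun i => (b i : G))
      (fun i => (b i).2) (by
        intro c y hy
        refine hv c (Subtype.ext ?_)
        have h1 : φ (Finsupp.linearCombination ℤ b c) =
            (Finsupp.linearCombination ℤ v c : φ.range) := by
          simp [Finsupp.linearCombination_apply, Finsupp.sum, map_sum, hb]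
        rw [← h1]
        refine (QuotientAddGroup.eq_zero_iff _).2 ⟨y, ?_⟩
        change p ^ (n + 1) • y = p ^ n • ((Finsupp.linearCombination ℤ b c : M) : G)
        rw [← hy]
        simp [Finsupp.linearCombination_apply, Finsupp.sum])
    let σ : (ℕ →₀ ZMod (p ^ (n + 1))) →+ (ℕ →₀ ZMod (p ^ (n + 1))) × ZMod (p ^ (n + 1)) :=
      AddMonoidHom.prod (Finsupp.comapDomain.addMonoidHom Nat.succ_injective)
        (Finsupp.applyAddHom 0)
    have hσ : Function.Surjective σ := by
      rintro ⟨f, a⟩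
      refine ⟨f.mapDomain Nat.succ + Finsupp.single 0 a, Prod.ext (Finsupp.ext fun i => ?_) ?_⟩
      · change (f.mapDomain Nat.succ + Finsupp.single 0 a : ℕ →₀ ZMod (p ^ (n + 1))) (i + 1) = f i
        rw [Finsupp.add_apply, Finsupp.mapDomain_apply Nat.succ_injective]
        simp
      · change (f.mapDomain Nat.succ + Finsupp.single 0 a : ℕ →₀ ZMod (p ^ (n + 1))) 0 = a
        rw [Finsupp.add_apply, Finsupp.mapDomain_of_notMem_range _ _ (by simp)]
        simp
    have hsub := hRH.subsingleton_of_retract r ι hr σ hσ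
    have : Fact (1 < p ^ (n + 1)) := ⟨Nat.one_lt_pow (by omega) hp.one_lt⟩
    exact not_subsingleton (ZMod (p ^ (n + 1))) hsub
  choose t ht using fun y : φ.range => y.2
  refine ⟨Set.range fun y => (t y : G), Set.finite_range _, fun x hx => ?_⟩
  refine ⟨_, ⟨⟨φ ⟨x, hx⟩, _, rfl⟩, rfl⟩, ?_⟩
  have h1 := ht ⟨φ ⟨x, hx⟩, _, rfl⟩
  obtain ⟨y, hy⟩ := QuotientAddGroup.eq.1 h1
  refine ⟨y, ?_⟩
  have hy' : p ^ (n + 1) • y = -(p ^ n • (t ⟨φ ⟨x, hx⟩, _, rfl⟩ : G)) + p ^ n • x := hy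
  rw [hy', add_neg_cancel_left]

/-! ### Surjections from unbounded groups -/

/-- An unbounded reduced `p`-group has cyclic direct summands of arbitrarily large order. Otherwise
all Ulm factors of finite index at least `N` vanish, and `p ^ N G` is divisible. -/
theorem exists_cyclic_summand {p : ℕ} (hp : p.Prime) {G : Type u} [AddCommGroup G]
    (hG : IsPrimary p G) (hr : IsReduced G) (hunb : ∀ N : ℕ, ∃ x : G, p ^ N • x ≠ 0) (N : ℕ) :
    ∃ n ≥ N, ∃ (b : G) (π : G →+ ZMod (p ^ n)), p ^ n • b = 0 ∧ π b = 1 := by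
  by_contra hcon
  have hpure : ∀ n ≥ N, ∀ x : G, p ^ (n + 1) • x = 0 → ∃ y, p ^ n • x = p ^ (n + 1) • y := by
    intro n hn x hx
    by_contra hxy
    refine hcon ⟨n + 1, by omega, x, ?_⟩
    obtain ⟨ι, r, hrι, hι⟩ := exists_retract_finsupp_zmod hp hG (fun _ : Unit => x)
      (fun _ => hx) (by
        intro c y hy i
        by_contra hpc
        obtain ⟨a, b, hab⟩ := ((Nat.prime_iff_prime_int.1 hp).coprime_iff_not_dvd).2 hpc
        have h1 : Finsupp.linearCombination ℤ (fun _ : Unit => x) c = c i • x := by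
          rw [Finsupp.unique_single c]
          simp
        rw [h1] at hy
        refine hxy ⟨b • y, ?_⟩
        have h2 : p ^ n • (a * p) • x = 0 := by
          rw [mul_smul, natCast_zsmul, smul_comm, smul_smul (p ^ n), ← pow_succ, hx, smul_zero]
        calc p ^ n • x = p ^ n • (a * p + b * c i) • x := by rw [hab, one_smul]
          _ = b • (p ^ n • c i • x) := by
            rw [add_smul, smul_add, h2, zero_add, mul_smul, smul_comm]
          _ = p ^ (n + 1) • b • y := by rw [hy, smul_comm])
    refine ⟨(Finsupp.applyAddHom ()).comp r, hx, ?_⟩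
    rw [← hι (), AddMonoidHom.comp_apply, hrι]
    simp
  have hdiv : ∀ k : ℕ, ∀ w : G, p ^ k • (p ^ N • w) = 0 → ∃ w', p • (p ^ N • w') = p ^ N • w := by
    intro k
    induction k with
    | zero =>
      intro w hw
      rw [pow_zero, one_smul] at hw
      exact ⟨0, by rw [hw, smul_zero, smul_zero]⟩
    | succ k ih =>
      intro w hw
      rw [smul_smul, ← pow_add, show k + 1 + N = k + N + 1 by omega] at hw
      obtain ⟨y, hy⟩ := hpure (k + N) (by omega) w hw
      obtain ⟨w', hw'⟩ := ih (w - p • y) (by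
        rw [smul_smul, ← pow_add, smul_sub, hy, smul_smul, ← pow_succ, sub_self])
      refine ⟨w' + y, ?_⟩
      rw [smul_add, smul_add, hw', smul_sub, smul_comm p (p ^ N) y, sub_add_cancel]
  have hbot := hr (nsmulAddMonoidHom (p ^ N) : G →+ G).range (hG.isDivisibleSubgroup hp (by
    rintro _ ⟨w, rfl⟩
    obtain ⟨k, hk⟩ := hG (p ^ N • w)
    obtain ⟨w', hw'⟩ := hdiv k w hk
    exact ⟨_, ⟨w', rfl⟩, hw'⟩))
  obtain ⟨x, hx⟩ := hunb N
  have hx' : p ^ N • x ∈ (nsmulAddMonoidHom (p ^ N) : G →+ G).range := ⟨x, rfl⟩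
  rw [hbot] at hx'
  exact hx hx'

/-- An unbounded reduced `p`-group maps onto every countable `p`-group `H`. Given generators `h i` of
order dividing `p ^ k i`, cyclic summands of order `p ^ n i` are mapped to the multiples of `h i`.
If `n i - k i` grows fast, every element of `G` is killed by almost all of these maps, and a generator
of the `i`-th summand is killed by all the maps with larger index. -/
theorem exists_surjective_of_countable {p : ℕ} (hp : p.Prime) {G : Type u} [AddCommGroup G]
    (hG : IsPrimary p G) (hr : IsReduced G) (hunb : ∀ N : ℕ, ∃ x : G, p ^ N • x ≠ 0)
    {H : Type v} [AddCommGroup H] (hH : IsPrimary p H) [Countable H] :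
    ∃ Φ : G →+ H, Function.Surjective Φ := by
  obtain ⟨h, hh⟩ := exists_surjective_nat H
  choose k hk using fun i => hH (h i)
  choose ν hν b π hb hπ using exists_cyclic_summand hp hG hr hunb
  let N : ℕ → ℕ := fun i => Nat.rec (k 0) (fun i M => ν M + k (i + 1) + 1) i
  let n : ℕ → ℕ := fun i => ν (N i)
  have hn0 : k 0 ≤ n 0 := hν (N 0)
  have hnsucc : ∀ i, n i + k (i + 1) + 1 ≤ n (i + 1) := fun i => hν (N (i + 1))
  have hnmono : StrictMono n := strictMono_nat_of_lt_succ fun i => by have := hnsucc i; omega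
  have hnk : ∀ i j, i < j → n i + k j ≤ n j := by
    intro i j hij
    obtain ⟨j, rfl⟩ := Nat.exists_eq_succ_of_ne_zero (Nat.ne_zero_of_lt hij)
    have h1 := hnmono.monotone (Nat.lt_succ_iff.1 hij)
    have h2 := hnsucc j
    simp only [Nat.succ_eq_add_one]
    omega
  have hnki : ∀ i, i + k i ≤ n i := by
    rintro (_ | i)
    · simpa using hn0
    · have h1 := hnsucc i
      have h2 := hnmono.le_apply (x := i)
      omega
  let χ : ∀ i, ZMod (p ^ n i) →+ H := fun i =>
    ZMod.lift (p ^ n i) ⟨zmultiplesHom H (h i), by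
      have h1 : p ^ n i = p ^ (n i - k i) * p ^ k i := by
        rw [← pow_add, Nat.sub_add_cancel]
        have := hnki i
        omega
      rw [zmultiplesHom_apply, natCast_zsmul, h1, mul_smul, hk, smul_zero]⟩
  have hχ : ∀ i (a : ℤ), χ i a = a • h i := fun i a => by
    simp only [χ, ZMod.lift_coe, zmultiplesHom_apply]
  let φ : ∀ i, G →+ H := fun i => (χ i).comp (π (N i))
  have hφmul : ∀ i x, ∃ a : ℤ, φ i x = a • h i := by
    intro i x
    obtain ⟨a, ha⟩ := ZMod.intCast_surjective (π (N i) x)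
    exact ⟨a, by rw [← hχ, ha]; rfl⟩
  have hφzero : ∀ i m x, p ^ m • x = 0 → m + k i ≤ n i → φ i x = 0 := by
    intro i m x hx hm
    obtain ⟨a, ha⟩ := ZMod.intCast_surjective (π (N i) x)
    have h1 : ((p ^ m * a : ℤ) : ZMod (p ^ n i)) = 0 := by
      have h2 := congrArg (π (N i)) hx
      rw [map_nsmul, map_zero, ← ha, nsmul_eq_mul] at h2
      push_cast at h2 ⊢
      exact h2
    rw [ZMod.intCast_zmod_eq_zero_iff_dvd] at h1
    have h3 : ((p : ℤ) ^ m * p ^ k i) ∣ (p : ℤ) ^ m * a := by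
      refine dvd_trans ?_ h1
      rw [← pow_add]
      push_cast
      exact pow_dvd_pow _ hm
    obtain ⟨c, rfl⟩ := Int.dvd_of_mul_dvd_mul_left
      (pow_ne_zero m (by exact_mod_cast hp.ne_zero)) h3
    change χ i (π (N i) x) = 0
    rw [← ha, hχ, mul_comm, mul_smul, ← Nat.cast_pow, natCast_zsmul, hk, smul_zero]
  have hsupp : ∀ x m, p ^ m • x = 0 →
      (Function.support fun i => φ i x) ⊆ (Finset.range m : Set ℕ) := by
    intro x m hx i hi
    by_contra him
    refine hi (hφzero i m x hx ?_)
    have h1 := hnki i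
    simp only [Finset.coe_range, Set.mem_Iio, not_lt] at him
    omega
  have hfin : ∀ x, (Function.support fun i => φ i x).Finite := fun x => by
    obtain ⟨m, hm⟩ := hG x
    exact (Finset.finite_toSet _).subset (hsupp x m hm)
  let Φ : G →+ H := AddMonoidHom.mk' (fun x => ∑ᶠ i, φ i x) fun x y => by
    simp only [map_add]
    exact finsum_add_distrib (hfin x) (hfin y)
  have hmem : ∀ i, h i ∈ Φ.range := by
    intro i
    induction i using Nat.strong_induction_on with
    | _ i ih =>
      have h1 : Φ (b (N i)) = ∑ j ∈ Finset.range i, φ j (b (N i)) + h i := by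
        have h2 : φ i (b (N i)) = h i := by
          change χ i (π (N i) (b (N i))) = h i
          rw [hπ]
          simpa using hχ i 1
        rw [← h2, ← Finset.sum_range_succ]
        refine finsum_eq_sum_of_support_subset _ fun j hj => ?_
        by_contra hji
        simp only [Finset.coe_range, Set.mem_Iio, not_lt] at hji
        exact hj (hφzero j (n i) _ (hb (N i)) (hnk i j hji))
      rw [← add_sub_cancel_left (∑ j ∈ Finset.range i, φ j (b (N i))) (h i), ← h1]
      refine AddSubgroup.sub_mem _ ⟨_, rfl⟩ (AddSubgroup.sum_mem _ fun j hj => ?_)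
      obtain ⟨a, ha⟩ := hφmul j (b (N i))
      rw [ha]
      exact AddSubgroup.zsmul_mem _ (ih j (Finset.mem_range.1 hj)) a
  refine ⟨Φ, fun y => ?_⟩
  obtain ⟨i, rfl⟩ := hh y
  exact hmem i

/-! ### Relatively Hopfian groups -/

/-- A subgroup `S` that contains representatives of all the Ulm factors of finite index generates
`G` modulo `p G`. -/
theorem exists_mem_add_nsmul {p : ℕ} {G : Type u} [AddCommGroup G] (hG : IsPrimary p G)
    {S : AddSubgroup G} (hS : ∀ (n : ℕ) (x : G), p ^ (n + 1) • x = 0 →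
      ∃ t ∈ S, ∃ y, p ^ n • x = p ^ n • t + p ^ (n + 1) • y) (x : G) :
    ∃ s ∈ S, ∃ y, x = s + p • y := by
  have key : ∀ n : ℕ, ∀ x : G, p ^ n • x = 0 → ∃ s ∈ S, ∃ y, x = s + p • y := by
    intro n
    induction n with
    | zero =>
      intro x hx
      rw [pow_zero, one_smul] at hx
      exact ⟨0, S.zero_mem, 0, by simp [hx]⟩
    | succ n ih =>
      intro x hx
      obtain ⟨t, ht, y, hy⟩ := hS n x hx
      obtain ⟨s, hs, z, hz⟩ := ih (x - t - p • y) (by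
        rw [smul_sub, smul_sub, hy, smul_smul, ← pow_succ, add_sub_cancel_left, sub_self])
      refine ⟨t + s, S.add_mem ht hs, y + z, ?_⟩
      rw [smul_add, add_add_add_comm, add_comm s, ← add_sub_cancel (t + p • y) x, ← sub_sub, hz]
      abel
  obtain ⟨n, hn⟩ := hG x
  exact key n x hn

/-- A bounded relatively Hopfian `p`-group is finitely generated, hence finite. -/
theorem IsRelativelyHopfian.finite_of_bounded {p : ℕ} (hp : p.Prime) {G : Type u} [AddCommGroup G]
    (hG : IsPrimary p G) (hRH : IsRelativelyHopfian G) {N : ℕ} (hN : ∀ x : G, p ^ N • x = 0) :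
    Finite G := by
  choose T hT hTx using hRH.exists_finite_set hp hG
  let S := AddSubgroup.closure (⋃ n ∈ Finset.range N, T n)
  have hS := exists_mem_add_nsmul hG (S := S) (by
    intro n x hx
    by_cases hn : n < N
    · obtain ⟨t, ht, y, hy⟩ := hTx n x hx
      exact ⟨t, AddSubgroup.subset_closure
        (Set.mem_iUnion₂.2 ⟨n, Finset.mem_range.2 hn, ht⟩), y, hy⟩
    · refine ⟨0, S.zero_mem, 0, ?_⟩
      obtain ⟨m, rfl⟩ := Nat.exists_eq_add_of_le (not_lt.1 hn)
      rw [add_comm, pow_add, mul_smul, hN]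
      simp)
  have hpow : ∀ m : ℕ, ∀ x : G, ∃ s ∈ S, ∃ y, x = s + p ^ m • y := by
    intro m
    induction m with
    | zero => exact fun x => ⟨0, S.zero_mem, x, by simp⟩
    | succ m ih =>
      intro x
      obtain ⟨s, hs, y, rfl⟩ := ih x
      obtain ⟨t, ht, z, rfl⟩ := hS y
      refine ⟨s + p ^ m • t, S.add_mem hs (S.nsmul_mem ht _), z, ?_⟩
      rw [smul_add, smul_smul, ← pow_succ, add_assoc]
  have hfg : AddGroup.FG G := by
    refine ⟨(AddSubgroup.fg_iff _).2 ⟨⋃ n ∈ Finset.range N, T n, ?_,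
      Set.Finite.biUnion (Finset.finite_toSet _) fun n _ => hT n⟩⟩
    rw [eq_top_iff]
    intro x _
    obtain ⟨s, hs, y, rfl⟩ := hpow N x
    rw [hN, add_zero]
    exact hs
  exact AddCommGroup.finite_of_fg_isAddTorsion G fun x =>
    isOfFinAddOrder_iff_nsmul_eq_zero.2 ⟨p ^ N, pow_pos hp.pos N, hN x⟩

/-- An unbounded countable reduced `p`-group `G` is not relatively Hopfian, as it maps onto the
countable `p`-group `G × ℤ / p`. -/
theorem IsRelativelyHopfian.finite_of_countable {p : ℕ} (hp : p.Prime) {G : Type u} [AddCommGroup G]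
    (hG : IsPrimary p G) (hr : IsReduced G) (hRH : IsRelativelyHopfian G) [Countable G] :
    Finite G := by
  by_cases hb : ∃ N : ℕ, ∀ x : G, p ^ N • x = 0
  · obtain ⟨N, hN⟩ := hb
    exact hRH.finite_of_bounded hp hG hN
  · push Not at hb
    have : NeZero p := ⟨hp.ne_zero⟩
    obtain ⟨Φ, hΦ⟩ := exists_surjective_of_countable hp hG hr hb (H := G × ZMod p) (by
      rintro ⟨x, a⟩
      obtain ⟨k, hk⟩ := hG x
      refine ⟨k + 1, Prod.ext ?_ ?_⟩
      · change p ^ (k + 1) • x = 0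
        rw [pow_succ', mul_smul, hk, smul_zero]
      · change p ^ (k + 1) • a = 0
        rw [nsmul_eq_mul]
        simp)
    have hsub := hRH.subsingleton_of_retract (AddMonoidHom.id G) (AddMonoidHom.id G)
      (fun _ => rfl) Φ hΦ
    have : Fact (1 < p) := ⟨hp.one_lt⟩
    exact absurd hsub (not_subsingleton (ZMod p))

/-- The subgroup generated by lifts of the (finite) Ulm factors of finite index is countable and
generates `G` modulo `p G`, so all the quotients `G / p ^ σ G` are countable. -/
theorem IsRelativelyHopfian.countable_of_isTotallyProjective {p : ℕ} (hp : p.Prime) {G : Type u}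
    [AddCommGroup G] (hG : IsTotallyProjective p G) (hr : IsReduced G)
    (hRH : IsRelativelyHopfian G) : Countable G := by
  choose T hT hTx using hRH.exists_finite_set hp hG.1
  have hS := exists_mem_add_nsmul hG.1 (S := AddSubgroup.closure (⋃ n, T n)) (by
    intro n x hx
    obtain ⟨t, ht, y, hy⟩ := hTx n x hx
    exact ⟨t, AddSubgroup.subset_closure (Set.mem_iUnion.2 ⟨n, ht⟩), y, hy⟩)
  obtain ⟨σ, hσ⟩ := hr.exists_primePow_eq_bot hp hG.1
  have hc := hG.countable_quotient (countable_addSubgroup_closure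
    (Set.countable_iUnion fun n => (hT n).countable)) hS σ
  rw [hσ] at hc
  exact (QuotientAddGroup.quotientBot (G := G)).symm.injective.countable

end AbGrp

theorem proposition3p13 (p : ℕ) (hp : p.Prime) :
    (∀ (G : Type u) [AddCommGroup G], AbGrp.IsPrimary p G → AbGrp.IsReduced G →
      AbGrp.IsRelativelyHopfian G → Countable G → Finite G) ∧
    (∀ (G : Type u) [AddCommGroup G], AbGrp.IsPrimary p G → AbGrp.IsReduced G →
      AbGrp.IsRelativelyHopfian G →
      ¬ ∃ H : AddSubgroup G, AbGrp.IsDirectSummand H ∧ Countable H ∧ Infinite H) ∧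
    (∀ (G : Type u) [AddCommGroup G], AbGrp.IsTotallyProjective p G → AbGrp.IsReduced G →
      ¬ AbGrp.IsBounded G → ¬ AbGrp.IsRelativelyHopfian G) := by
  refine ⟨fun G _ hG hr hRH _ => hRH.finite_of_countable hp hG hr, ?_, ?_⟩
  · rintro G _ hG hr hRH ⟨H, ⟨K, hHK⟩, hc, hinf⟩
    have hHK' : IsCompl H.toIntSubmodule K.toIntSubmodule :=
      (AddSubgroup.toIntSubmodule (M := G)).isCompl_iff.1 hHK
    let r : G →+ H := (Submodule.projectionOnto _ _ hHK').toAddMonoidHom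
    have hrH : ∀ h : H, r h = h := fun h => Submodule.projectionOnto_apply_left hHK' h
    have hH : AbGrp.IsRelativelyHopfian H := fun A _ φ hφ =>
      hRH.subsingleton_of_retract r H.subtype hrH φ hφ
    have hHp : AbGrp.IsPrimary p H := fun x => by
      obtain ⟨k, hk⟩ := hG x
      exact ⟨k, Subtype.ext hk⟩
    have hHr : AbGrp.IsReduced H := by
      intro D hD
      have h1 := hr (D.map H.subtype) (by
        rintro n hn _ ⟨x, hx, rfl⟩
        obtain ⟨y, hy, rfl⟩ := hD n hn x hx
        exact ⟨y, ⟨y, hy, rfl⟩, rfl⟩)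
      exact (AddSubgroup.map_eq_bot_iff_of_injective D H.subtype_injective).1 h1
    exact not_finite_iff_infinite.2 hinf (hH.finite_of_countable hp hHp hHr)
  · intro G _ hG hr hb hRH
    have := hRH.countable_of_isTotallyProjective hp hG hr
    have := hRH.finite_of_countable hp hG.1 hr
    exact hb ⟨Nat.card G, Nat.card_pos, fun x => card_nsmul_eq_zero'⟩
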